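/- Call a triple $(a,b,c)$ of positive integers \emph{index-realizable} if there exist a group $G$ and finite-index subgroups $H, K \le G$ such that $a = [G:H]$, $b = [G:K]$ and $c = [G : H\cap K]$. Let $n$ be a positive integer and let $p$ be a prime such that $p+1 < n < 2p$. (1) The triple $(n, n, np)$ is not index-realizable. (2) For every positive integer $\ell$, the triple $(n, n\ell, np\ell)$ is index-realizable if and only if $\binom{n}{p}$ divides $n\ell$. -/

import Mathlib

universe u

/-- A triple `(a, b, c)` is index-realizable if there are a group `G` and finite-index subgroups
`H` and `K` of `G` with `[G : H] = a`, `[G : K] = b` and `[G : H ∩ K] = c`. The entries are then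
automatically positive, since `H`, `K` and `H ⊓ K` have finite index. -/
def IndexRealizable (a b c : ℕ) : Prop :=
  ∃ (G : Type u) (_ : Group G) (H K : Subgroup G),
    H.FiniteIndex ∧ K.FiniteIndex ∧ H.index = a ∧ K.index = b ∧ (H ⊓ K).index = c

/-!
Let `G` be a group with subgroups `H`, `K` of indices `n` and `nℓ`, and `[G : H ⊓ K] = npℓ`.
Then `K` has, in its action on the `n` points of `G ⧸ H`, an orbit of size
`[K : H ⊓ K] = p`. Hence `p` divides the order of the permutation group induced by `G`, and by
Cauchy's theorem that group contains an element of order `p`, which is a `p`-cycle because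
`n < 2p`. Its support has more than half of the points, so the transitive action of `G` is
primitive; as the cycle fixes `n - p ≥ 2` points, Jordan's theorem makes the action
`(n - p + 1)`-fold transitive. In particular `G` is transitive on the sets of `n - p` points, hence
on their complements, the sets of `p` points (`isPretransitive_powersetCard_of_prime_dvd_card`).
Since `K` stabilizes a set of `p` points, its index is a multiple of the index `n.choose p` of the
stabilizer of that set (`IndexRealizable.choose_dvd`).

Conversely, if `nℓ = m * n.choose p`, take the product of the symmetric group on `n` points with a
group of order `m`, let `H` be the stabilizer of a point, and let `K` be the stabilizer, in the
symmetric group alone, of a set of `p` points containing that point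
(`indexRealizable_of_choose_dvd`).

The triple `(n, n, np)` is the case `ℓ = 1`, which is excluded because `n < n.choose p`.
-/

open MulAction Set
open scoped Pointwise

theorem lt_choose_of_two_le_of_add_two_le {n k : ℕ} (hk : 2 ≤ k) (hkn : k + 2 ≤ n) :
    n < n.choose k := by
  induction n generalizing k with
  | zero => omega
  | succ n ih =>
    obtain ⟨j, rfl⟩ : ∃ j, k = j + 1 := ⟨k - 1, by omega⟩
    rw [Nat.choose_succ_succ']
    rcases Nat.lt_or_ge j 2 with hj | hj
    · obtain rfl : j = 1 := by omega
      have : Nat.choose 3 2 ≤ n.choose 2 := Nat.choose_mono 2 (by omega)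
      have h3 : Nat.choose 3 2 = 3 := by decide
      simp only [Nat.choose_one_right, Nat.reduceAdd]
      omega
    · have h1 := ih hj (by omega)
      have h2 : 0 < n.choose (j + 1) := Nat.choose_pos (by omega)
      omega

section Transitivity

variable {X : Type*}

/-- A permutation of prime order `p` on fewer than `2 * p` points moves exactly `p` points. By
Jordan's theorem, a transitive permutation group containing it is highly transitive. -/
theorem isMultiplyPretransitive_of_orderOf_eq_prime [Finite X] {p : ℕ} (hp : p.Prime)
    (hpX : p + 1 < Nat.card X) (hXp : Nat.card X < 2 * p) {Γ : Subgroup (Equiv.Perm X)}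
    [IsPretransitive Γ X] {σ : Equiv.Perm X} (hσ : σ ∈ Γ) (hσp : orderOf σ = p) :
    IsMultiplyPretransitive Γ X (Nat.card X - p) := by
  classical
  have := Fintype.ofFinite X
  have hcyc : σ.IsCycle := Equiv.Perm.isCycle_of_prime_order' (hσp ▸ hp)
    (by rwa [hσp, ← Nat.card_eq_fintype_card])
  have hsupp : σ.support.card = p := hcyc.orderOf.symm.trans hσp
  set s : Set X := (σ.support : Set X)ᶜ with hs
  have hsc : s.ncard = Nat.card X - p := by
    rw [hs, Set.ncard_compl, Set.ncard_coe_finset, hsupp]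
  have hcoe : (SubMulAction.ofFixingSubgroup Γ s : Set X) = σ.support := by
    ext x
    rw [SetLike.mem_coe, SubMulAction.mem_ofFixingSubgroup_iff, hs, Set.mem_compl_iff, not_not]
  have htrans := Equiv.Perm.isPretransitive_of_isCycle_mem hcyc hσ
  have hcard : Nat.card (SubMulAction.ofFixingSubgroup Γ s) = p := by
    change Nat.card (SubMulAction.ofFixingSubgroup Γ s : Set X) = p
    rw [hcoe, Nat.card_coe_set_eq, Set.ncard_coe_finset, hsupp]
  have hprim : IsPreprimitive (fixingSubgroup Γ s) (SubMulAction.ofFixingSubgroup Γ s) :=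
    IsPreprimitive.of_prime_card (hcard ▸ hp)
  -- More than half of the points lie in the support, on which the action is primitive.
  have hΓ : IsPreprimitive Γ X := by
    let f : SubMulAction.ofFixingSubgroup Γ s →ₑ[(fixingSubgroup Γ s).subtype] X :=
      ⟨Subtype.val, fun _ _ ↦ rfl⟩
    apply IsPreprimitive.of_card_lt (f := f)
    have hf : (range f).ncard = p :=
      (Set.ncard_range_of_injective Subtype.val_injective).trans hcard
    rwa [hf]
  have := (hΓ.isMultiplyPreprimitive (n := Nat.card X - p - 1) (hsc.trans (by omega))
    (by have := hp.two_le; omega) hprim).isMultiplyPretransitive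
  refine isMultiplyPretransitive_of_le (n := Nat.card X - p - 1 + 2) (by omega) ?_
  have := hp.two_le
  omega

/-- A transitive action on `n` points is transitive on the sets of `p` points, where `p` is a prime
with `p + 1 < n < 2 * p`, as soon as `p` divides the order of the induced permutation group. -/
theorem isPretransitive_powersetCard_of_prime_dvd_card [Finite X] [DecidableEq X] {G : Type*}
    [Group G] [MulAction G X] [IsPretransitive G X] {p : ℕ} (hp : p.Prime)
    (hpX : p + 1 < Nat.card X) (hXp : Nat.card X < 2 * p)
    (hdvd : p ∣ Nat.card (toPermHom G X).range) :
    IsPretransitive G (powersetCard X p) := by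
  have := Fintype.ofFinite X
  have : Fact p.Prime := ⟨hp⟩
  obtain ⟨⟨σ, hσ⟩, hσp⟩ := exists_prime_orderOf_dvd_card' p hdvd
  rw [Subgroup.orderOf_mk] at hσp
  have : IsPretransitive (toPermHom G X).range X :=
    ⟨fun x y ↦ by
      obtain ⟨g, hg⟩ := exists_smul_eq G x y
      exact ⟨⟨toPermHom G X g, g, rfl⟩, hg⟩⟩
  -- Transitivity on the sets of `Nat.card X - p` points passes to their complements.
  have hcompl := powersetCard.isPretransitive_of_isMultiplyPretransitive (toPermHom G X).range
    (isMultiplyPretransitive_of_orderOf_eq_prime hp hpX hXp hσ hσp)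
  have hp' : IsPretransitive (toPermHom G X).range (powersetCard X p) :=
    IsPretransitive.of_surjective_map (powersetCard.mulActionHom_compl_bijective
      (toPermHom G X).range X (by rw [← Nat.card_eq_fintype_card]; omega)).surjective hcompl
  refine ⟨fun s t ↦ ?_⟩
  obtain ⟨⟨_, g, rfl⟩, hg⟩ := exists_smul_eq (toPermHom G X).range s t
  exact ⟨g, hg⟩

end Transitivity

/-- The `K`-orbit of the trivial coset in `G ⧸ H` is a set of `p` points stabilized by `K`, so the
index of `K` is a multiple of the number of such sets, which `G` permutes transitively. -/
theorem IndexRealizable.choose_dvd {n p b : ℕ} (hp : p.Prime) (hpn : p + 1 < n)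
    (hnp : n < 2 * p) (hb : 0 < b) (h : IndexRealizable.{u} n b (p * b)) :
    n.choose p ∣ b := by
  classical
  obtain ⟨G, _, H, K, hH, hK, rfl, rfl, hHK⟩ := h
  have : Finite (G ⧸ H) := Subgroup.finite_quotient_of_finiteIndex
  have := Fintype.ofFinite (G ⧸ H)
  set x : G ⧸ H := ((1 : G) : G ⧸ H)
  have hstab : stabilizer K x = H.subgroupOf K := by
    ext k
    rw [mem_stabilizer_iff, Subgroup.mem_subgroupOf]
    have := SetLike.ext_iff.mp (stabilizer_quotient H) (k : G)
    exact this
  have horb : (orbit K x).ncard = p := by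
    rw [← index_stabilizer, hstab]
    have h1 : (H ⊓ K).relIndex K * K.index = (H ⊓ K).index :=
      Subgroup.relIndex_mul_index inf_le_right
    rw [hHK, Subgroup.inf_relIndex_right] at h1
    exact Nat.eq_of_mul_eq_mul_right hb h1
  have hdvd : p ∣ Nat.card (toPermHom G (G ⧸ H)).range := by
    have h1 : orbit (K.map (toPermHom G (G ⧸ H))) x = orbit K x := by
      ext y
      constructor
      · rintro ⟨⟨_, k, hk, rfl⟩, rfl⟩
        exact ⟨⟨k, hk⟩, rfl⟩
      · rintro ⟨k, rfl⟩
        exact ⟨⟨_, k, k.2, rfl⟩, rfl⟩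
    rw [← horb, ← h1, ← index_stabilizer]
    exact (Subgroup.index_dvd_card _).trans (Subgroup.card_dvd_of_le (Subgroup.map_le_range _ _))
  have := isPretransitive_powersetCard_of_prime_dvd_card hp hpn hnp hdvd
  let s : powersetCard (G ⧸ H) p :=
    ⟨(orbit K x).toFinset, by
      rw [powersetCard.mem_iff, ← Set.ncard_eq_toFinset_card', horb]⟩
  have hle : K ≤ stabilizer G s := by
    intro k hk
    have hs : (s : Set (G ⧸ H)) = orbit K x := Set.coe_toFinset _
    rw [powersetCard.stabilizer_coe, mem_stabilizer_iff, hs]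
    exact smul_orbit (⟨k, hk⟩ : K) x
  have hidx : (stabilizer G s).index = H.index.choose p := by
    rw [index_stabilizer_of_transitive, powersetCard.card]
    rfl
  exact hidx ▸ Subgroup.index_dvd_of_le hle

theorem orbit_stabilizer_perm_eq {X : Type*} [DecidableEq X] {p : ℕ} (s : powersetCard X p)
    {a : X} (ha : a ∈ (s : Finset X)) :
    orbit (stabilizer (Equiv.Perm X) s) a = ((s : Finset X) : Set X) := by
  ext b
  constructor
  · rintro ⟨⟨g, hg⟩, rfl⟩
    have : g • (s : Finset X) = s := congrArg Subtype.val hg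
    have h2 : g • a ∈ g • (s : Finset X) := Finset.smul_mem_smul_finset ha
    rwa [this] at h2
  · intro hb
    refine ⟨⟨Equiv.swap a b, ?_⟩, Equiv.swap_apply_left a b⟩
    rw [powersetCard.stabilizer_coe]
    exact Equiv.Perm.swap_mem_stabilizer ha hb

theorem indexRealizable_of_choose_dvd {n p b : ℕ} (hp : 0 < p) (hpn : p ≤ n) (hb : 0 < b)
    (h : n.choose p ∣ b) : IndexRealizable.{u} n b (p * b) := by
  classical
  obtain ⟨m, rfl⟩ := h
  have hm : m ≠ 0 := by rintro rfl; simp at hb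
  have : NeZero m := ⟨hm⟩
  -- `H` will contain the factor `Z` and `K` will meet it trivially, so that `Z` leaves the index of
  -- `H` unchanged and multiplies those of `K` and `H ⊓ K` by `m`.
  let X := ULift.{u} (Fin n)
  let Z := Multiplicative (ULift.{u} (ZMod m))
  have hX : Nat.card X = n := by simp [X]
  have hZ : Nat.card Z = m := by simp [Z]
  have : Finite Z := Nat.finite_of_card_ne_zero (hZ ▸ hm)
  obtain ⟨t, -, ht⟩ := Finset.exists_subset_card_eq (s := (Finset.univ : Finset X)) (n := p)
    (by rwa [Finset.card_univ, ← Nat.card_eq_fintype_card, hX])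
  obtain ⟨a, ha⟩ := Finset.card_pos.mp (ht ▸ hp)
  let s : powersetCard X p := ⟨t, ht⟩
  have := powersetCard.isPretransitive (α := X) (n := p)
  have ha_index : (stabilizer (Equiv.Perm X) a).index = n := by
    rw [index_stabilizer_of_transitive, hX]
  have hs_index : (stabilizer (Equiv.Perm X) s).index = n.choose p := by
    rw [index_stabilizer_of_transitive, powersetCard.card, hX]
  have hinf : (stabilizer (Equiv.Perm X) a ⊓ stabilizer (Equiv.Perm X) s).index
      = p * n.choose p := by
    rw [← Subgroup.relIndex_mul_index inf_le_right, Subgroup.inf_relIndex_right, hs_index]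
    have h1 : (stabilizer (Equiv.Perm X) a).subgroupOf (stabilizer (Equiv.Perm X) s)
      = stabilizer (stabilizer (Equiv.Perm X) s) a := rfl
    rw [Subgroup.relIndex, h1, index_stabilizer, orbit_stabilizer_perm_eq s ha,
      Set.ncard_coe_finset]
    exact congrArg (· * _) ht
  refine ⟨Equiv.Perm X × Z, inferInstance, (stabilizer (Equiv.Perm X) a).prod ⊤,
    (stabilizer (Equiv.Perm X) s).prod ⊥, inferInstance, inferInstance, ?_, ?_, ?_⟩
  · rw [Subgroup.index_prod, ha_index, Subgroup.index_top, mul_one]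
  · rw [Subgroup.index_prod, hs_index, Subgroup.index_bot, hZ]
  · have hprod : (stabilizer (Equiv.Perm X) a).prod (⊤ : Subgroup Z) ⊓
        (stabilizer (Equiv.Perm X) s).prod ⊥ =
        (stabilizer (Equiv.Perm X) a ⊓ stabilizer (Equiv.Perm X) s).prod ⊥ := by
      ext ⟨g, z⟩
      simp only [Subgroup.mem_inf, Subgroup.mem_prod, Subgroup.mem_top]
      tauto
    rw [hprod, Subgroup.index_prod, hinf, Subgroup.index_bot, hZ, mul_assoc]

theorem mainTheorem1 (n p : ℕ) (hp : p.Prime) (hpn : p + 1 < n) (hnp : n < 2 * p) :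
    ¬ IndexRealizable.{u} n n (n * p) ∧
      ∀ ℓ : ℕ, 0 < ℓ →
        (IndexRealizable.{u} n (n * ℓ) (n * p * ℓ) ↔ n.choose p ∣ n * ℓ) := by
  have hn : 0 < n := by omega
  constructor
  · intro h
    rw [mul_comm] at h
    exact (lt_choose_of_two_le_of_add_two_le hp.two_le hpn).not_ge
      (Nat.le_of_dvd hn (h.choose_dvd hp hpn hnp hn))
  · intro ℓ hℓ
    have hb : 0 < n * ℓ := Nat.mul_pos hn hℓ
    rw [show n * p * ℓ = p * (n * ℓ) by ring]
    exact ⟨fun h ↦ h.choose_dvd hp hpn hnp hb,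
      indexRealizable_of_choose_dvd hp.pos (by omega) hb⟩
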